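/- Theorem (Continuation Principle in Euclidean spaces, with its corollary). Let $k\ge 0$ be an integer. (a) Let $U\subseteq\mathbb R^k$ be bounded and open, let $f:\overline U\to\mathbb R^k$ be continuous and of class $C^1$ in a neighborhood of $f^{-1}(0)$, and let $h:\overline U\times[0,1]\to\mathbb R^k$ be continuous. Assume that 1. $h(x,0)=0$ for all $x\in U$; 2. $f(x)+h(x,\lambda)\neq 0$ for all $(x,\lambda)\in\partial U\times[0,1]$; 3. $\det f'(x)\neq 0$ for every $x\in f^{-1}(0)$. Then $f^{-1}(0)$ is finite, and if the integer $\sum_{x\in f^{-1}(0)}\operatorname{sign}(\det f'(x))$ is nonzero, then the equation $f(x)+h(x,1)=0$ has at least one solution in $U$. (b) Let $L:\mathbb R^k\to\mathbb R^k$ be linear and $g:\mathbb R^k\to\mathbb R^k$ continuous. If the set $$S=\{x\in\mathbb R^k : Lx+\lambda g(x)=0\ \text{for some}\ \lambda\in[0,1]\}$$ is bounded, then the equation $Lx+g(x)=0$ has at least one solution. -/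

import Mathlib

/-- The zeros, in the closure of `U`, of a map `f` which is only regarded as a map on `closure U`
(its values elsewhere are irrelevant). -/
def zerosOnClosure {k : ℕ} (U : Set (EuclideanSpace ℝ (Fin k)))
    (f : EuclideanSpace ℝ (Fin k) → EuclideanSpace ℝ (Fin k)) : Set (EuclideanSpace ℝ (Fin k)) :=
  {x | x ∈ closure U ∧ f x = 0}

/-- The sign of the Jacobian determinant of `f` at `x`, as an integer. -/
noncomputable def jacobianSign {k : ℕ}
    (f : EuclideanSpace ℝ (Fin k) → EuclideanSpace ℝ (Fin k)) (x : EuclideanSpace ℝ (Fin k)) : ℤ :=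
  ((SignType.sign (fderiv ℝ f x).det : SignType) : ℤ)

/-! The degree is handled as an integral. Suppose F(x,t) = f(x) + h(x,t) has no zero at t = 1; by
hypothesis it has none on the lateral boundary. Replace F by a smooth G, uniformly close to it and,
at time 0, equal to the linearization of f on a small ball around each zero. Take a bump φ supported
in a ball too small for G to enter it on the lateral boundary or at time 1. The top-degree form
φ·vol is closed, hence so is its pullback by G, and Stokes on the cylinder U × [0,1] gives ∫ φ(G)
det G' = 0 at time 0 (`setIntegral_mul_det_eq_zero`). There the integral localizes to the balls, and
a linear change of variables on each turns it into (∑ sign det f'(a)) ∫ φ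
(`setIntegral_mul_det_eq_sum`). As ∫ φ > 0, the signed count is 0.

For the corollary, boundedness of S forces L to be injective, so on a large ball L has the single
zero 0, of sign ±1, and h(x,t) = t g(x) is admissible. -/

open MeasureTheory Set Filter Topology

/-! ### Space-time coordinates and Stokes on a cylinder -/

/-- The projection of space-time `Fin (k + 1) → ℝ` (time first) to space. -/
noncomputable def spaceProj (k : ℕ) : (Fin (k + 1) → ℝ) →L[ℝ] EuclideanSpace ℝ (Fin k) :=
  (EuclideanSpace.equiv (Fin k) ℝ).symm.toContinuousLinearMap ∘L
    ContinuousLinearMap.pi fun i : Fin k => ContinuousLinearMap.proj i.succ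

@[simp]
theorem spaceProj_apply {k : ℕ} (w : Fin (k + 1) → ℝ) (i : Fin k) :
    spaceProj k w i = w i.succ := rfl

/-- The point of space-time with time `t` and position `x`. -/
def atTime {k : ℕ} (t : ℝ) (x : EuclideanSpace ℝ (Fin k)) : Fin (k + 1) → ℝ :=
  Fin.cons t (x : Fin k → ℝ)

@[simp]
theorem atTime_zero {k : ℕ} (t : ℝ) (x : EuclideanSpace ℝ (Fin k)) : atTime t x 0 = t := rfl

@[simp]
theorem atTime_succ {k : ℕ} (t : ℝ) (x : EuclideanSpace ℝ (Fin k)) (i : Fin k) :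
    atTime t x i.succ = x i := rfl

@[simp]
theorem spaceProj_atTime {k : ℕ} (t : ℝ) (x : EuclideanSpace ℝ (Fin k)) :
    spaceProj k (atTime t x) = x := by
  ext i; simp

@[simp]
theorem atTime_spaceProj {k : ℕ} (w : Fin (k + 1) → ℝ) : atTime (w 0) (spaceProj k w) = w := by
  ext i; refine Fin.cases ?_ (fun j => ?_) i <;> simp

/-- The spatial coordinate vectors of space-time. -/
def spaceVec {k : ℕ} (i : Fin k) : Fin (k + 1) → ℝ := Pi.single i.succ 1

/-- The coordinate vectors of space-time with the `i`-th one omitted. -/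
def coordVecsOmit {k : ℕ} (i : Fin (k + 1)) : Fin k → Fin (k + 1) → ℝ :=
  fun j => Pi.single (i.succAbove j) 1

theorem coordVecsOmit_zero (k : ℕ) : coordVecsOmit (0 : Fin (k + 1)) = spaceVec := by
  ext i j; simp [coordVecsOmit, spaceVec]

theorem setIntegral_box_indicator {k : ℕ} {U : Set (EuclideanSpace ℝ (Fin k))} (hU : IsOpen U)
    {a b : Fin k → ℝ} (hab : ∀ x ∈ U, (x : Fin k → ℝ) ∈ Icc a b)
    (q : EuclideanSpace ℝ (Fin k) → ℝ) :
    ∫ y in Icc a b, U.indicator q (WithLp.toLp 2 y) = ∫ x in U, q x := by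
  rw [setIntegral_eq_integral_of_forall_compl_eq_zero, ← integral_indicator hU.measurableSet]
  · exact (PiLp.volume_preserving_toLp (Fin k)).integral_comp
      (MeasurableEquiv.toLp 2 (Fin k → ℝ)).measurableEmbedding (U.indicator q)
  · intro y hy
    exact indicator_of_notMem (fun h => hy (hab _ h)) _

/-- Stokes' theorem on a cylinder for a closed form that vanishes near the lateral boundary. -/
theorem setIntegral_slice_eq_of_extDeriv_eq_zero {k : ℕ} {U : Set (EuclideanSpace ℝ (Fin k))}
    (hU : IsOpen U) (hUb : Bornology.IsBounded U)
    {Ω : (Fin (k + 1) → ℝ) → (Fin (k + 1) → ℝ) [⋀^Fin k]→L[ℝ] ℝ}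
    (hΩ : Differentiable ℝ Ω) (hd : ∀ w, extDeriv Ω w = 0)
    (hbd : ∀ w, spaceProj k w ∈ frontier U → w 0 ∈ Icc (0 : ℝ) 1 → ∀ᶠ z in 𝓝 w, Ω z = 0) :
    ∫ x in U, Ω (atTime 1 x) spaceVec = ∫ x in U, Ω (atTime 0 x) spaceVec := by
  classical
  obtain ⟨R, hR⟩ := hUb.subset_ball 0
  have hRU : ∀ x ∈ U, ∀ i, |x i| < R := fun x hx i => by
    have h1 := hR hx
    rw [mem_ball_zero_iff] at h1
    exact lt_of_le_of_lt (by simpa using PiLp.norm_apply_le x i) h1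
  let S : Set (Fin (k + 1) → ℝ) := spaceProj k ⁻¹' U
  -- With these signs the divergence of `v` is `extDeriv Ω` evaluated on the coordinate frame.
  let v : Fin (k + 1) → (Fin (k + 1) → ℝ) → ℝ := fun i w =>
    (-1) ^ (i : ℕ) * Ω w (coordVecsOmit i)
  have hv : ∀ i, Differentiable ℝ (v i) := fun i => by
    have : Differentiable ℝ fun w => Ω w (coordVecsOmit i) := fun w =>
      ((ContinuousAlternatingMap.apply ℝ (Fin (k+1) → ℝ) ℝ
        (coordVecsOmit i)).differentiableAt).comp w (hΩ w)
    exact this.const_mul _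
  -- Extension by zero reduces the cylinder over U to a box; it stays differentiable because Ω
  -- vanishes near the lateral boundary.
  let V : Fin (k + 1) → (Fin (k + 1) → ℝ) → ℝ := fun i => S.indicator (v i)
  have hVd : ∀ w, w 0 ∈ Icc (0 : ℝ) 1 → ∀ i,
      HasFDerivAt (V i) (if w ∈ S then fderiv ℝ (v i) w else 0) w := by
    intro w hw i
    by_cases hwS : w ∈ S
    · rw [if_pos hwS]
      refine (hv i w).hasFDerivAt.congr_of_eventuallyEq ?_
      filter_upwards [(hU.preimage (spaceProj k).continuous).mem_nhds hwS] with z hz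
      exact indicator_of_mem hz _
    · rw [if_neg hwS]
      refine (hasFDerivAt_const (0 : ℝ) w).congr_of_eventuallyEq ?_
      by_cases hwf : spaceProj k w ∈ frontier U
      · filter_upwards [hbd w hwf hw] with z hz
        simp [V, indicator, v, hz]
      · have hc : spaceProj k w ∈ (closure U)ᶜ := fun hc =>
          hwf ⟨hc, fun h => hwS (interior_subset (s := U) h)⟩
        filter_upwards [(isClosed_closure.isOpen_compl.preimage
          (spaceProj k).continuous).mem_nhds hc] with z hz
        exact indicator_of_notMem (s := S) (fun h => hz (subset_closure h)) _
  -- The absolute value keeps a ≤ b even when U is empty and R is negative.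
  let a : Fin (k + 1) → ℝ := Fin.cons 0 fun _ => -|R|
  let b : Fin (k + 1) → ℝ := Fin.cons 1 fun _ => |R|
  have hab : a ≤ b := by
    intro i
    refine Fin.cases ?_ (fun j => ?_) i
    · simp [a, b]
    · simp [a, b]
  have hzero : ∀ w, ∑ i, (if w ∈ S then fderiv ℝ (v i) w else 0) (Pi.single i 1) = 0 := by
    intro w
    by_cases hwS : w ∈ S
    · have h1 := congrArg (fun F => F fun j => (Pi.single j 1 : Fin (k + 1) → ℝ)) (hd w)
      simp only [extDeriv_apply (hΩ w)] at h1
      simp only [if_pos hwS]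
      refine Eq.trans (Finset.sum_congr rfl fun i _ => ?_) h1
      have : DifferentiableAt ℝ (fun w => Ω w (coordVecsOmit i)) w :=
        ((ContinuousAlternatingMap.apply ℝ (Fin (k+1) → ℝ) ℝ
        (coordVecsOmit i)).differentiableAt).comp w (hΩ w)
      simp only [v]
      rw [fderiv_const_mul this]
      simp
      rfl
    · simp [hwS]
  have key := integral_divergence_of_hasFDerivAt_off_countable' a b hab V
    (fun i w => if w ∈ S then fderiv ℝ (v i) w else 0) ∅ countable_empty
    (fun i w hw => (hVd w (by simpa [a, b] using And.intro (hw.1 0) (hw.2 0))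
      i).continuousAt.continuousWithinAt)
    (fun w hw i => hVd w (by
      have := hw.1 0 (mem_univ _)
      exact Ioo_subset_Icc_self (by simpa [a, b] using this)) i)
    (by simp only [hzero]; exact integrableOn_zero)
  simp only [hzero, integral_zero] at key
  rw [Fin.sum_univ_succ] at key
  have hside : ∀ (i : Fin k) (c : ℝ) (y : Fin k → ℝ), |R| ≤ |c| →
      V i.succ (i.succ.insertNth c y) = 0 := by
    intro i c y hc
    refine indicator_of_notMem (fun h => ?_) _
    have := hRU _ h i
    simp only [spaceProj_apply, Fin.insertNth_apply_same] at this
    exact absurd (hc.trans_lt this) (not_lt.2 (le_abs_self R))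
  have hface : ∀ c : ℝ, ∫ y in Icc (a ∘ Fin.succAbove 0) (b ∘ Fin.succAbove 0),
      V 0 ((0 : Fin (k + 1)).insertNth c y) = ∫ x in U, Ω (atTime c x) spaceVec := by
    intro c
    rw [← setIntegral_box_indicator hU (a := a ∘ Fin.succAbove 0) (b := b ∘ Fin.succAbove 0)]
    · congr 1
      ext y
      have : ((0 : Fin (k + 1)).insertNth c y : Fin (k + 1) → ℝ) =
          atTime c (WithLp.toLp 2 y) := by
        simp [atTime]
      simp only [V, S, v, this, coordVecsOmit_zero, indicator, mem_preimage,
        spaceProj_atTime]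
      simp
    · intro x hx
      constructor <;> intro i <;> have := abs_le.1 ((hRU x hx i).le.trans (le_abs_self R)) <;>
        simp [a, b, this.1, this.2]
  rw [hface, hface, Finset.sum_eq_zero] at key
  · simpa [a, b, sub_eq_zero] using key.symm
  · intro i _
    have h1 : |R| ≤ |b i.succ| := by simp [b]
    have h2 : |R| ≤ |a i.succ| := by simp [a]
    simp only [hside i _ _ h1, hside i _ _ h2]
    simp

/-! ### Pullback of a top-degree form and the degree integral -/

/-- The standard volume form on Euclidean space. -/
noncomputable def euclideanVolumeForm (k : ℕ) :
    EuclideanSpace ℝ (Fin k) [⋀^Fin k]→L[ℝ] ℝ :=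
  { (EuclideanSpace.basisFun (Fin k) ℝ).toBasis.det with
    cont := by
      change Continuous fun v => (EuclideanSpace.basisFun (Fin k) ℝ).toBasis.det v
      simp only [Module.Basis.det_apply]
      refine Continuous.matrix_det (continuous_matrix fun i j => ?_)
      simp only [Module.Basis.toMatrix_apply, OrthonormalBasis.coe_toBasis_repr_apply,
        EuclideanSpace.basisFun_repr]
      fun_prop }

theorem euclideanVolumeForm_apply_clm {k : ℕ}
    (A : EuclideanSpace ℝ (Fin k) →L[ℝ] EuclideanSpace ℝ (Fin k)) :
    euclideanVolumeForm k (fun i => A (EuclideanSpace.single i 1)) = A.det := by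
  have h := (EuclideanSpace.basisFun (Fin k) ℝ).toBasis.det_comp (A : _ →ₗ[ℝ] _)
    (EuclideanSpace.basisFun (Fin k) ℝ).toBasis
  rw [Module.Basis.det_self, mul_one] at h
  rw [ContinuousLinearMap.det, ← h]
  change (EuclideanSpace.basisFun (Fin k) ℝ).toBasis.det _ = _
  congr 1
  ext i
  simp

theorem AlternatingMap.eq_zero_of_finrank_lt {n : ℕ} {E : Type*} [AddCommGroup E] [Module ℝ E]
    [FiniteDimensional ℝ E] (h : Module.finrank ℝ E < n) (ω : E [⋀^Fin n]→ₗ[ℝ] ℝ) : ω = 0 := by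
  ext v
  refine ω.map_linearDependent v fun hv => ?_
  have := hv.fintype_card_le_finrank
  simp at this
  omega

theorem hasFDerivAt_atTime {k : ℕ} (t : ℝ) (x : EuclideanSpace ℝ (Fin k)) :
    ∃ D : EuclideanSpace ℝ (Fin k) →L[ℝ] (Fin (k + 1) → ℝ), HasFDerivAt (atTime t) D x ∧
      ∀ i, D (EuclideanSpace.single i 1) = spaceVec i := by
  let D : EuclideanSpace ℝ (Fin k) →L[ℝ] (Fin (k + 1) → ℝ) :=
    ContinuousLinearMap.pi (Fin.cons 0 fun i => EuclideanSpace.proj i)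
  refine ⟨D, ?_, fun i => ?_⟩
  · have h : (atTime t : EuclideanSpace ℝ (Fin k) → _) =
        fun x => D x + atTime t (0 : EuclideanSpace ℝ (Fin k)) := by
      ext x i
      refine Fin.cases ?_ (fun j => ?_) i <;> simp [D]
    rw [h]
    exact D.hasFDerivAt.add_const _
  · ext j
    refine Fin.cases ?_ (fun j => ?_) j
    · simp [D, spaceVec]
    · simp [D, spaceVec, Pi.single_apply]

/-- Homotopy invariance of the degree integral of a smooth map. -/
theorem setIntegral_mul_det_eq_zero {k : ℕ} {U : Set (EuclideanSpace ℝ (Fin k))}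
    (hU : IsOpen U) (hUb : Bornology.IsBounded U)
    {G : (Fin (k + 1) → ℝ) → EuclideanSpace ℝ (Fin k)} (hG : ContDiff ℝ 2 G)
    {φ : EuclideanSpace ℝ (Fin k) → ℝ} (hφ : Differentiable ℝ φ) {δ : ℝ}
    (hφδ : ∀ y, δ ≤ ‖y‖ → φ y = 0)
    (hbd : ∀ x ∈ frontier U, ∀ t ∈ Icc (0 : ℝ) 1, δ < ‖G (atTime t x)‖)
    (h1 : ∀ x ∈ U, δ ≤ ‖G (atTime 1 x)‖) :
    ∫ x in U, φ (G (atTime 0 x)) * (fderiv ℝ (fun y => G (atTime 0 y)) x).det = 0 := by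
  let ω : EuclideanSpace ℝ (Fin k) → EuclideanSpace ℝ (Fin k) [⋀^Fin k]→L[ℝ] ℝ :=
    fun y => φ y • euclideanVolumeForm k
  have hω : Differentiable ℝ ω := hφ.smul_const _
  let Ω : (Fin (k + 1) → ℝ) → (Fin (k + 1) → ℝ) [⋀^Fin k]→L[ℝ] ℝ :=
    fun w => (ω (G w)).compContinuousLinearMap (fderiv ℝ G w)
  have hGd : Differentiable ℝ G := hG.differentiable (by norm_num)
  have hΩ : Differentiable ℝ Ω := by
    have := (hG.fderiv_right (m := 1) (by norm_num)).differentiable (by norm_num)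
    intro w
    exact ((hω (G w)).comp w (hGd w)).continuousAlternatingMapCompContinuousLinearMap (this w)
  have hd : ∀ w, extDeriv Ω w = 0 := by
    intro w
    have h2 := extDeriv_pullback (hω (G w)) (hG.contDiffAt (x := w)) (by simp)
    refine h2.trans ?_
    -- A (k+1)-form on a k-dimensional space is zero.
    have h3 : extDeriv ω (G w) = 0 := by
      apply ContinuousAlternatingMap.toAlternatingMap_injective
      exact AlternatingMap.eq_zero_of_finrank_lt (by simp) _
    rw [h3]
    ext v
    simp
  have key := setIntegral_slice_eq_of_extDeriv_eq_zero hU hUb hΩ hd (by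
    intro w hw ht
    have h2 := hbd _ hw _ ht
    rw [atTime_spaceProj] at h2
    filter_upwards [(hGd.continuous.norm.tendsto w).eventually_const_lt h2] with z hz
    ext v
    simp [Ω, ω, hφδ _ hz.le])
  rw [setIntegral_eq_zero_of_forall_eq_zero] at key
  · refine Eq.trans ?_ key.symm
    congr 1
    ext x
    obtain ⟨D, hD, hDe⟩ := hasFDerivAt_atTime 0 x
    have hf : fderiv ℝ (fun y => G (atTime 0 y)) x = (fderiv ℝ G (atTime 0 x)).comp D :=
      ((hGd (atTime 0 x)).hasFDerivAt.comp x hD).fderiv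
    rw [hf, ← euclideanVolumeForm_apply_clm]
    simp only [Ω, ω, ContinuousAlternatingMap.compContinuousLinearMap_apply,
      ContinuousAlternatingMap.smul_apply, smul_eq_mul]
    congr 2
    ext i
    simp [hDe]
  · intro x hx
    simp [Ω, ω, hφδ _ (h1 x hx)]

/-- The change of variables contributes 1/|det A|, which leaves only the sign of the factor det A.
-/
theorem integral_comp_sub_mul_det {k : ℕ}
    (A : EuclideanSpace ℝ (Fin k) →L[ℝ] EuclideanSpace ℝ (Fin k)) (hA : A.det ≠ 0)
    (a : EuclideanSpace ℝ (Fin k)) (φ : EuclideanSpace ℝ (Fin k) → ℝ) :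
    ∫ x, φ (A (x - a)) * A.det = (SignType.sign A.det : ℝ) * ∫ y, φ y := by
  rw [integral_sub_right_eq_self (fun x => φ (A x) * A.det) a, integral_mul_const]
  have hemb : MeasurableEmbedding (A : EuclideanSpace ℝ (Fin k) → EuclideanSpace ℝ (Fin k)) :=
    (A.toContinuousLinearEquivOfDetNeZero hA).toHomeomorph.measurableEmbedding
  have h := hemb.integral_map (μ := volume) φ
  have hmap := Measure.map_linearMap_addHaar_eq_smul_addHaar
    (volume : Measure (EuclideanSpace ℝ (Fin k))) (f := (A : _ →ₗ[ℝ] _)) hA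
  rw [ContinuousLinearMap.coe_coe] at hmap
  rw [hmap, integral_smul_measure, ENNReal.toReal_ofReal (abs_nonneg _), smul_eq_mul] at h
  rw [← h]
  change |A.det⁻¹| * _ * A.det = _
  rw [abs_inv]
  have h0 : |A.det| ≠ 0 := abs_ne_zero.2 hA
  have h1 := sign_mul_abs A.det
  field_simp
  linear_combination (-(∫ y, φ y)) * h1

/-- The degree integral of a map that is affine near each of its finitely many zeros. -/
theorem setIntegral_mul_det_eq_sum {k : ℕ} {U : Set (EuclideanSpace ℝ (Fin k))} (hU : IsOpen U)
    (Z : Finset (EuclideanSpace ℝ (Fin k)))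
    (A : EuclideanSpace ℝ (Fin k) → EuclideanSpace ℝ (Fin k) →L[ℝ] EuclideanSpace ℝ (Fin k))
    (hA : ∀ a ∈ Z, (A a).det ≠ 0) {r δ : ℝ}
    (hball : ∀ a ∈ Z, Metric.ball a r ⊆ U)
    (hdisj : (Z : Set (EuclideanSpace ℝ (Fin k))).PairwiseDisjoint fun a => Metric.ball a r)
    {g : EuclideanSpace ℝ (Fin k) → EuclideanSpace ℝ (Fin k)}
    (hgA : ∀ a ∈ Z, ∀ x ∈ Metric.ball a r, g x = A a (x - a))
    (hgδ : ∀ x ∈ U, (∀ a ∈ Z, r ≤ dist x a) → δ ≤ ‖g x‖)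
    (hAδ : ∀ a ∈ Z, ∀ v, r ≤ ‖v‖ → δ ≤ ‖A a v‖)
    {φ : EuclideanSpace ℝ (Fin k) → ℝ} (hφ : Continuous φ) (hφδ : ∀ y, δ ≤ ‖y‖ → φ y = 0) :
    ∫ x in U, φ (g x) * (fderiv ℝ g x).det =
      (∑ a ∈ Z, (SignType.sign (A a).det : ℝ)) * ∫ y, φ y := by
  have hUnion : ⋃ a ∈ Z, Metric.ball a r ⊆ U := iUnion₂_subset hball
  have hloc : ∀ a ∈ Z, ∀ x ∈ Metric.ball a r,
      φ (g x) * (fderiv ℝ g x).det = φ (A a (x - a)) * (A a).det := by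
    intro a ha x hx
    have : HasFDerivAt g (A a) x := by
      refine HasFDerivAt.congr_of_eventuallyEq (f := fun x => A a (x - a)) ?_ ?_
      · exact (A a).hasFDerivAt.comp x ((hasFDerivAt_id x).sub_const a)
      · filter_upwards [Metric.isOpen_ball.mem_nhds hx] with y hy using hgA a ha y hy
    rw [this.fderiv, hgA a ha x hx]
  have hzero : ∀ a ∈ Z, ∀ x ∉ Metric.ball a r, φ (A a (x - a)) * (A a).det = 0 := by
    intro a ha x hx
    rw [hφδ _ (hAδ a ha _ ?_), zero_mul]
    simpa [dist_eq_norm] using hx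
  rw [setIntegral_eq_of_subset_of_forall_sdiff_eq_zero hU.measurableSet hUnion fun x hx => by
    have hx2 : ∀ a ∈ Z, r ≤ dist x a := by simpa using hx.2
    rw [hφδ _ (hgδ x hx.1 hx2), zero_mul]]
  rw [integral_biUnion_finset Z (fun a _ => Metric.isOpen_ball.measurableSet) hdisj]
  · rw [Finset.sum_mul]
    refine Finset.sum_congr rfl fun a ha => ?_
    rw [← integral_comp_sub_mul_det (A a) (hA a ha) a φ,
      setIntegral_congr_fun Metric.isOpen_ball.measurableSet (hloc a ha),
      setIntegral_eq_integral_of_forall_compl_eq_zero (hzero a ha)]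
  · intro a ha
    refine IntegrableOn.congr_fun ?_ (fun x hx => (hloc a ha x hx).symm)
      Metric.isOpen_ball.measurableSet
    have : Continuous fun x => φ (A a (x - a)) * (A a).det := by fun_prop
    exact (this.continuousOn.integrableOn_compact (isCompact_closedBall a r)).mono_set
      Metric.ball_subset_closedBall

/-! ### Nondegenerate zeros -/

open scoped ContDiff Manifold

theorem ContinuousLinearMap.exists_pos_antilipschitz_of_det_ne_zero {k : ℕ}
    {A : EuclideanSpace ℝ (Fin k) →L[ℝ] EuclideanSpace ℝ (Fin k)} (hA : A.det ≠ 0) :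
    ∃ C : NNReal, 0 < C ∧ AntilipschitzWith C A := by
  have hk : A.toLinearMap.ker = ⊥ := by
    by_contra h
    exact hA (LinearMap.det_eq_zero_iff_ker_ne_bot.2 h)
  exact A.toLinearMap.exists_antilipschitzWith hk

/-- An infinite zero set would accumulate at a zero by compactness, but an injective derivative
makes each zero isolated. -/
theorem finite_zeros_of_det_ne_zero {k : ℕ} {K : Set (EuclideanSpace ℝ (Fin k))}
    (hK : IsCompact K) {f : EuclideanSpace ℝ (Fin k) → EuclideanSpace ℝ (Fin k)}
    (hf : ContinuousOn f K)
    {A : EuclideanSpace ℝ (Fin k) → EuclideanSpace ℝ (Fin k) →L[ℝ] EuclideanSpace ℝ (Fin k)}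
    (hfA : ∀ a ∈ K, f a = 0 → HasFDerivAt f (A a) a)
    (hA : ∀ a ∈ K, f a = 0 → (A a).det ≠ 0) :
    {x | x ∈ K ∧ f x = 0}.Finite := by
  by_contra hinf
  have hc : IsCompact {x | x ∈ K ∧ f x = 0} :=
    hK.of_isClosed_subset (hf.preimage_isClosed_of_isClosed hK.isClosed isClosed_singleton)
      fun x hx => hx.1
  obtain ⟨a, ha, hacc⟩ := Set.Infinite.exists_accPt_of_subset_isCompact hinf hc subset_rfl
  obtain ⟨C, -, hC⟩ :=
    ContinuousLinearMap.exists_pos_antilipschitz_of_det_ne_zero (hA a ha.1 ha.2)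
  have h1 := (hfA a ha.1 ha.2).eventually_ne (c := 0) ⟨C, hC⟩
  rw [accPt_iff_frequently_nhdsNE] at hacc
  exact hacc (h1.mono fun x hx hx2 => hx hx2.2)

theorem IsCompact.exists_pos_forall_le_norm {X E : Type*} [TopologicalSpace X]
    [NormedAddCommGroup E] {K : Set X} (hK : IsCompact K) {f : X → E} (hf : ContinuousOn f K)
    (h0 : ∀ x ∈ K, f x ≠ 0) : ∃ m > 0, ∀ x ∈ K, m ≤ ‖f x‖ :=
  hK.exists_forall_le' hf.norm fun x hx => norm_pos_iff.2 (h0 x hx)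

/-- Uniform control of a map on small balls around its nondegenerate zeros. -/
theorem exists_linearization_radius {k : ℕ} {K U : Set (EuclideanSpace ℝ (Fin k))}
    (hK : IsCompact K) (hU : IsOpen U) {f : EuclideanSpace ℝ (Fin k) → EuclideanSpace ℝ (Fin k)}
    (hf : ContinuousOn f K) (Z : Finset (EuclideanSpace ℝ (Fin k))) (hZU : ∀ a ∈ Z, a ∈ U)
    (hZ0 : ∀ a ∈ Z, f a = 0) (hZ : ∀ x ∈ K, f x = 0 → x ∈ Z)
    {A : EuclideanSpace ℝ (Fin k) → EuclideanSpace ℝ (Fin k) →L[ℝ] EuclideanSpace ℝ (Fin k)}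
    (hfA : ∀ a ∈ Z, HasFDerivAt f (A a) a) (hA : ∀ a ∈ Z, (A a).det ≠ 0) :
    ∃ c > 0, ∃ r₀ > 0, (∀ a ∈ Z, ∀ v, 4 * c * ‖v‖ ≤ ‖A a v‖) ∧ ∀ r, 0 < r → r ≤ r₀ →
      (∀ a ∈ Z, Metric.closedBall a r ⊆ U) ∧
      ((Z : Set (EuclideanSpace ℝ (Fin k))).PairwiseDisjoint fun a => Metric.closedBall a r) ∧
      (∀ a ∈ Z, ∀ x ∈ Metric.closedBall a r, ‖A a (x - a) - f x‖ ≤ c * r) ∧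
      (∀ x ∈ K, (∀ a ∈ Z, r ≤ dist x a) → 3 * c * r ≤ ‖f x‖) := by
  -- The 4 is an error budget: linearization costs c‖x - a‖, leaving 3c‖x - a‖ for f; the later
  -- smoothing costs 2cr, leaving more than cr at distance r.
  have hc : ∀ᶠ c : ℝ in 𝓝[>] 0, ∀ a ∈ Z, ∀ v, 4 * c * ‖v‖ ≤ ‖A a v‖ := by
    rw [Filter.eventually_all_finset]
    intro a ha
    obtain ⟨C, hC0, hC⟩ :=
      ContinuousLinearMap.exists_pos_antilipschitz_of_det_ne_zero (hA a ha)
    have hC0' : (0 : ℝ) < C := hC0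
    filter_upwards [Ioo_mem_nhdsGT (show (0 : ℝ) < 1 / (4 * C) by positivity)] with c hc v
    have h1 := hC.le_mul_dist v 0
    simp only [map_zero, dist_zero_right] at h1
    have h2 : c * (4 * C) < 1 := (lt_div_iff₀ (by positivity)).1 hc.2
    calc 4 * c * ‖v‖ ≤ 4 * c * (C * ‖A a v‖) := by
          have := hc.1
          gcongr
      _ = (c * (4 * C)) * ‖A a v‖ := by ring
      _ ≤ 1 * ‖A a v‖ := by gcongr
      _ = ‖A a v‖ := one_mul _
  obtain ⟨c, hcA, hc0⟩ := (hc.and self_mem_nhdsWithin).exists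
  have hc0 : 0 < c := hc0
  have hR : ∀ᶠ R : ℝ in 𝓝[>] 0, ∀ a ∈ Z, ∀ x ∈ Metric.closedBall a R,
      x ∈ U ∧ ‖A a (x - a) - f x‖ ≤ c * ‖x - a‖ := by
    rw [Filter.eventually_all_finset]
    intro a ha
    have h1 : ∀ᶠ x in 𝓝 a, x ∈ U ∧ ‖A a (x - a) - f x‖ ≤ c * ‖x - a‖ := by
      filter_upwards [hU.mem_nhds (hZU a ha), (hfA a ha).isLittleO.def hc0] with x hx hx2
      refine ⟨hx, ?_⟩
      rw [norm_sub_rev]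
      simpa [hZ0 a ha] using hx2
    obtain ⟨ε, hε, h2⟩ := Metric.eventually_nhds_iff_ball.1 h1
    filter_upwards [Ioo_mem_nhdsGT hε] with R hR x hx
    exact h2 x (Metric.closedBall_subset_ball hR.2 hx)
  obtain ⟨R, hRA, hR0⟩ := (hR.and self_mem_nhdsWithin).exists
  have hR0 : 0 < R := hR0
  have hlow : ∀ a ∈ Z, ∀ x ∈ Metric.closedBall a R, 3 * c * dist x a ≤ ‖f x‖ := by
    intro a ha x hx
    have h1 := hcA a ha (x - a)
    have h2 := (hRA a ha x hx).2
    have h3 := norm_sub_norm_le (A a (x - a)) (f x)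
    rw [dist_eq_norm]
    linarith
  obtain ⟨m, hm0, hm⟩ := (hK.diff (isOpen_biUnion fun a (_ : a ∈ Z) =>
    Metric.isOpen_ball (x := a) (ε := R))).exists_pos_forall_le_norm (hf.mono sdiff_subset)
    (fun x hx h0 => hx.2 (mem_biUnion (hZ x hx.1 h0) (Metric.mem_ball_self hR0)))
  refine ⟨c, hc0, min (R / 2) (m / (3 * c)), by positivity, hcA, fun r hr0 hr => ?_⟩
  have hrR : r ≤ R / 2 := hr.trans (min_le_left _ _)
  have hrm : 3 * c * r ≤ m := by
    have := hr.trans (min_le_right _ _)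
    rw [le_div_iff₀ (by positivity)] at this
    linarith
  have hsub : ∀ a : EuclideanSpace ℝ (Fin k), Metric.closedBall a r ⊆ Metric.closedBall a R := fun a =>
    Metric.closedBall_subset_closedBall (by linarith)
  refine ⟨fun a ha x hx => (hRA a ha x (hsub a hx)).1, ?_, ?_, ?_⟩
  · intro a ha b hb hab
    rw [Function.onFun, Set.disjoint_left]
    intro x hxa hxb
    refine hab ?_
    -- Overlapping balls put b within R of a, where the lower bound on ‖f‖ allows no zero but a.
    have h1 : dist b a ≤ R := by
      have h2 := dist_triangle_left b a x
      rw [Metric.mem_closedBall] at hxa hxb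
      linarith
    have h2 := hlow a ha b h1
    rw [hZ0 b hb, norm_zero] at h2
    have h3 : dist b a ≤ 0 := by
      by_contra h
      push Not at h
      have : 0 < 3 * c * dist b a := by positivity
      linarith
    exact (dist_le_zero.1 h3).symm
  · intro a ha x hx
    refine (hRA a ha x (hsub a hx)).2.trans ?_
    rw [← dist_eq_norm]
    gcongr
    exact hx
  · intro x hx hxr
    by_cases hxb : ∃ a ∈ Z, x ∈ Metric.ball a R
    · obtain ⟨a, ha, hxa⟩ := hxb
      refine le_trans ?_ (hlow a ha x (Metric.ball_subset_closedBall hxa))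
      gcongr
      exact hxr a ha
    · refine hrm.trans (hm x ⟨hx, ?_⟩)
      simpa using hxb

/-! ### Smooth approximation -/

/-- Smooth approximation of a map that is continuous on a closed set, with prescribed values on
finitely many disjoint closed sets. -/
theorem exists_contDiff_approx_of_pairwiseDisjoint {W E ι : Type*} [NormedAddCommGroup W]
    [NormedSpace ℝ W] [FiniteDimensional ℝ W] [NormedAddCommGroup E] [NormedSpace ℝ E]
    {C : Set W} (hC : IsClosed C) {F : W → E} (hF : ContinuousOn F C) {η : ℝ} (hη : 0 < η)
    (Z : Finset ι) {S : ι → Set W} (hS : ∀ a ∈ Z, IsClosed (S a))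
    (hdisj : (Z : Set ι).PairwiseDisjoint S)
    {g : ι → W → E} (hg : ∀ a ∈ Z, ContDiff ℝ ∞ (g a))
    (hgF : ∀ a ∈ Z, ∀ w ∈ S a, ‖g a w - F w‖ < η) :
    ∃ G : W → E, ContDiff ℝ ∞ G ∧ (∀ w ∈ C, ‖G w - F w‖ < η) ∧
      ∀ a ∈ Z, ∀ w ∈ S a, G w = g a w := by
  classical
  -- Admissible values form a convex set, so local smooth choices glue by a partition of unity;
  -- singleton fibres over S a make the prescribed values exact.
  let t : W → Set E := fun w =>
    {y | (w ∈ C → y ∈ Metric.ball (F w) η) ∧ ∀ a ∈ Z, w ∈ S a → y ∈ ({g a w} : Set E)}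
  have ht : ∀ w, Convex ℝ (t w) := by
    intro w
    have h1 : t w = (⋂ (_ : w ∈ C), Metric.ball (F w) η) ∩
        ⋂ a ∈ Z, ⋂ (_ : w ∈ S a), ({g a w} : Set E) := by
      ext y; simp [t]
    rw [h1]
    exact (convex_iInter fun _ => convex_ball _ _).inter
      (convex_iInter₂ fun _ _ => convex_iInter fun _ => convex_singleton _)
  have hclosed : ∀ Z' ⊆ Z, IsClosed (⋃ a ∈ Z', S a) := fun Z' hZ' =>
    Set.Finite.isClosed_biUnion Z'.finite_toSet fun a ha => hS a (hZ' ha)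
  have hnear : ∀ (w : W) (p : W → E), Continuous p → (w ∈ C → ‖p w - F w‖ < η) →
      ∀ᶠ z in 𝓝 w, z ∈ C → p z ∈ Metric.ball (F z) η := by
    intro w p hp hpw
    by_cases hw : w ∈ C
    · refine eventually_nhdsWithin_iff.1 ?_
      have h1 : ContinuousWithinAt (fun z => ‖p z - F z‖) C w :=
        (hp.continuousWithinAt.sub (hF w hw)).norm
      filter_upwards [h1.tendsto.eventually_lt_const (hpw hw)] with z hz
      rwa [Metric.mem_ball, dist_eq_norm]
    · filter_upwards [hC.isOpen_compl.mem_nhds hw] with z hz hz2 using absurd hz2 hz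
  have hloc : ∀ w, ∃ N ∈ 𝓝 w, ∃ p : W → E, CMDiff[N] ∞ p ∧ ∀ z ∈ N, p z ∈ t z := by
    intro w
    by_cases hw : ∃ a ∈ Z, w ∈ S a
    · obtain ⟨a, ha, hwa⟩ := hw
      have h1 := hnear w (g a) (hg a ha).continuous fun _ => hgF a ha w hwa
      have h2 : ∀ᶠ z in 𝓝 w, z ∉ ⋃ b ∈ Z.erase a, S b := by
        refine (hclosed _ (Finset.erase_subset _ _)).isOpen_compl.mem_nhds fun h => ?_
        obtain ⟨b, hb, hwb⟩ := mem_iUnion₂.1 h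
        rw [Finset.mem_erase] at hb
        exact Set.disjoint_left.1 (hdisj hb.2 ha hb.1) hwb hwa
      refine ⟨_, h1.and h2, g a, (hg a ha).contMDiff.contMDiffOn, fun z hz => ⟨hz.1, ?_⟩⟩
      intro b hb hzb
      by_cases hba : b = a
      · rw [hba]; rfl
      · exact absurd (mem_biUnion (Finset.mem_erase.2 ⟨hba, hb⟩) hzb) hz.2
    · have h1 := hnear w (fun _ => F w) continuous_const fun _ => by simpa using hη
      have h2 : ∀ᶠ z in 𝓝 w, z ∉ ⋃ b ∈ Z, S b :=
        (hclosed Z subset_rfl).isOpen_compl.mem_nhds (by simpa using hw)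
      refine ⟨_, h1.and h2, fun _ => F w, contMDiffOn_const, fun z hz => ⟨hz.1, ?_⟩⟩
      intro b hb hzb
      exact absurd (mem_biUnion (s := (Z : Set ι)) hb hzb) hz.2
  obtain ⟨G, hG⟩ := exists_contMDiffMap_forall_mem_convex_of_local (n := ⊤) 𝓘(ℝ, W) ht hloc
  refine ⟨G, G.contMDiff.contDiff, fun w hw => ?_, fun a ha w hw => (hG w).2 a ha hw⟩
  simpa [dist_eq_norm] using (hG w).1 hw

/-! ### Vanishing of the signed count -/

/-- If a homotopy has no zero on the lateral boundary and none at the final time, then the signed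
count of the nondegenerate zeros of the initial map vanishes. -/
theorem sum_sign_det_eq_zero_of_homotopy {k : ℕ} {U : Set (EuclideanSpace ℝ (Fin k))}
    (hU : IsOpen U) (hUb : Bornology.IsBounded U)
    {F : EuclideanSpace ℝ (Fin k) → ℝ → EuclideanSpace ℝ (Fin k)}
    (hF : ContinuousOn (fun p : EuclideanSpace ℝ (Fin k) × ℝ => F p.1 p.2)
      (closure U ×ˢ Icc (0 : ℝ) 1))
    (hbd : ∀ x ∈ frontier U, ∀ t ∈ Icc (0 : ℝ) 1, F x t ≠ 0)
    (h1 : ∀ x ∈ U, F x 1 ≠ 0)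
    (Z : Finset (EuclideanSpace ℝ (Fin k))) (hZU : ∀ a ∈ Z, a ∈ U)
    (hZ : ∀ x ∈ closure U, F x 0 = 0 ↔ x ∈ Z)
    {A : EuclideanSpace ℝ (Fin k) → EuclideanSpace ℝ (Fin k) →L[ℝ] EuclideanSpace ℝ (Fin k)}
    (hfA : ∀ a ∈ Z, HasFDerivAt (fun x => F x 0) (A a) a) (hA : ∀ a ∈ Z, (A a).det ≠ 0) :
    ∑ a ∈ Z, (SignType.sign (A a).det : ℝ) = 0 := by
  have hK : IsCompact (closure U) := hUb.isCompact_closure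
  have hslice : ∀ t ∈ Icc (0 : ℝ) 1, ContinuousOn (fun x => F x t) (closure U) := fun t ht =>
    hF.comp (f := fun x => (x, t)) (by fun_prop) fun x hx => ⟨hx, ht⟩
  obtain ⟨c, hc0, r₀, hr₀, hcA, hr⟩ := exists_linearization_radius hK hU
    (hslice 0 (by simp)) Z hZU (fun a ha => (hZ a (subset_closure (hZU a ha))).2 ha)
    (fun x hx => (hZ x hx).1) hfA hA
  obtain ⟨m₁, hm₁, hm₁F⟩ := (hK.of_isClosed_subset isClosed_frontier
    frontier_subset_closure |>.prod isCompact_Icc).exists_pos_forall_le_norm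
    (hF.mono (prod_mono frontier_subset_closure subset_rfl)) (fun p hp => hbd _ hp.1 _ hp.2)
  obtain ⟨m₂, hm₂, hm₂F⟩ := hK.exists_pos_forall_le_norm (hslice 1 (by simp)) (fun x hx => by
    by_cases hxU : x ∈ U
    · exact h1 x hxU
    · exact hbd x ⟨hx, fun h => hxU (interior_subset h)⟩ 1 (by simp))
  obtain ⟨r, hr0, hrr₀, hrm₁, hrm₂⟩ : ∃ r > 0, r ≤ r₀ ∧ 3 * c * r ≤ m₁ ∧ 3 * c * r ≤ m₂ := by
    refine ⟨min r₀ (min (m₁ / (3 * c)) (m₂ / (3 * c))), by positivity, min_le_left _ _, ?_, ?_⟩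
    · rw [mul_comm, ← le_div_iff₀ (by positivity)]
      exact (min_le_right _ _).trans (min_le_left _ _)
    · rw [mul_comm, ← le_div_iff₀ (by positivity)]
      exact (min_le_right _ _).trans (min_le_right _ _)
  obtain ⟨hrU, hrdisj, hrlin, hrlow⟩ := hr r hr0 hrr₀
  have hcr : 0 < c * r := by positivity
  let C : Set (Fin (k + 1) → ℝ) := {w | spaceProj k w ∈ closure U ∧ w 0 ∈ Icc (0 : ℝ) 1}
  have hC : IsClosed C := (isClosed_closure.preimage (spaceProj k).continuous).inter
    (isClosed_Icc.preimage (continuous_apply 0))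
  -- Prescribing G on the time-0 slice suffices: the count only involves the spatial derivative
  -- there.
  let S : EuclideanSpace ℝ (Fin k) → Set (Fin (k + 1) → ℝ) := fun a =>
    {w | spaceProj k w ∈ Metric.closedBall a r ∧ w 0 = 0}
  obtain ⟨G, hG, hGF, hGS⟩ := exists_contDiff_approx_of_pairwiseDisjoint hC
    -- The tolerance 2cr exceeds the linearization error cr, so the affine maps are admissible, and
    -- stays below 3cr, so ‖G‖ > cr wherever ‖F‖ ≥ 3cr.
    (F := fun w => F (spaceProj k w) (w 0)) (η := 2 * (c * r))
    (hF.comp (f := fun w : Fin (k + 1) → ℝ => (spaceProj k w, w 0)) (by fun_prop) fun w hw => hw)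
    (by positivity) Z (S := S)
    (fun a _ => (Metric.isClosed_closedBall.preimage (spaceProj k).continuous).inter
      (isClosed_singleton.preimage (continuous_apply 0)))
    (fun a ha b hb hab => Set.disjoint_left.2 fun w hwa hwb =>
      Set.disjoint_left.1 (hrdisj ha hb hab) hwa.1 hwb.1)
    (g := fun a w => A a (spaceProj k w - a))
    (fun a _ => by fun_prop)
    (fun a ha w hw => by
      have := hrlin a ha _ hw.1
      rw [hw.2]
      linarith)
  have hGlow : ∀ x ∈ closure U, ∀ t ∈ Icc (0 : ℝ) 1, 3 * c * r ≤ ‖F x t‖ →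
      c * r < ‖G (atTime t x)‖ := by
    intro x hx t ht hxt
    have h2 := hGF (atTime t x) (by simpa [C] using ⟨hx, ht⟩)
    simp only [spaceProj_atTime, atTime_zero] at h2
    have h3 := norm_sub_norm_le (F x t) (G (atTime t x))
    rw [norm_sub_rev] at h3
    linarith
  let φ : ContDiffBump (0 : EuclideanSpace ℝ (Fin k)) :=
    { rIn := c * r / 2, rOut := c * r, rIn_pos := by positivity, rIn_lt_rOut := by linarith }
  have hφδ : ∀ y, c * r ≤ ‖y‖ → φ y = 0 := fun y hy =>
    φ.zero_of_le_dist (by simpa using hy)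
  have hint := setIntegral_mul_det_eq_zero hU hUb (contDiff_infty.1 hG 2)
    (φ := φ) ((φ.contDiff (n := 1)).differentiable (by norm_num)) hφδ
    (fun x hx t ht => hGlow x (frontier_subset_closure hx) t ht
      (hrm₁.trans (hm₁F (x, t) ⟨hx, ht⟩)))
    (fun x hx => (hGlow x (subset_closure hx) 1 (by simp)
      (hrm₂.trans (hm₂F x (subset_closure hx)))).le)
  rw [setIntegral_mul_det_eq_sum hU Z A hA (r := r) (δ := c * r)
    (fun a ha => Metric.ball_subset_closedBall.trans (hrU a ha))
    (hrdisj.mono_on fun a _ => Metric.ball_subset_closedBall)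
    (fun a ha x hx => by
      have := hGS a ha (atTime 0 x) ⟨by simpa using hx.le, by simp⟩
      simpa using this)
    (fun x hx hxr => (hGlow x (subset_closure hx) 0 (by simp)
      (hrlow x (subset_closure hx) hxr)).le)
    (fun a ha v hv => by
      refine le_trans ?_ (hcA a ha v)
      have : c * r ≤ c * ‖v‖ := by gcongr
      have : 0 ≤ c * ‖v‖ := by positivity
      linarith)
    φ.continuous hφδ] at hint
  exact (mul_eq_zero.1 hint).resolve_right φ.integral_pos.ne'

/-! ### The continuation principle and its corollary -/

theorem finite_zeros_and_exists_solution {k : ℕ} {U : Set (EuclideanSpace ℝ (Fin k))}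
    {f : EuclideanSpace ℝ (Fin k) → EuclideanSpace ℝ (Fin k)}
    {h : EuclideanSpace ℝ (Fin k) → ℝ → EuclideanSpace ℝ (Fin k)}
    (hU : IsOpen U) (hUb : Bornology.IsBounded U) (hf : ContinuousOn f (closure U))
    (hfV : ∃ V : Set (EuclideanSpace ℝ (Fin k)), IsOpen V ∧ zerosOnClosure U f ⊆ V ∧
        ContDiffOn ℝ 1 f (V ∩ U))
    (hh : ContinuousOn (fun p : EuclideanSpace ℝ (Fin k) × ℝ => h p.1 p.2)
        (closure U ×ˢ Icc (0 : ℝ) 1))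
    (h0 : ∀ x ∈ U, h x 0 = 0)
    (hbd : ∀ x ∈ frontier U, ∀ t ∈ Icc (0 : ℝ) 1, f x + h x t ≠ 0)
    (hdet : ∀ x ∈ zerosOnClosure U f, (fderiv ℝ f x).det ≠ 0) :
    (zerosOnClosure U f).Finite ∧
      ((∑ᶠ x ∈ zerosOnClosure U f, jacobianSign f x) ≠ 0 → ∃ x ∈ U, f x + h x 1 = 0) := by
  -- By continuity h(·,0) also vanishes on the frontier, so the boundary condition at t = 0 keeps
  -- the zeros of f inside U.
  have h0' : EqOn (fun x => h x 0) (fun _ => 0) (closure U) := by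
    refine EqOn.of_subset_closure (s := U) h0 ?_ continuousOn_const subset_closure subset_rfl
    exact hh.comp (f := fun x => (x, (0 : ℝ))) (by fun_prop) fun x hx => ⟨hx, by simp⟩
  have hZU : ∀ a ∈ zerosOnClosure U f, a ∈ U := by
    intro a ha
    by_contra haU
    have hfr : a ∈ frontier U := ⟨ha.1, fun h => haU (interior_subset h)⟩
    refine hbd a hfr 0 (by simp) ?_
    rw [ha.2, zero_add]
    exact h0' ha.1
  obtain ⟨V, hV, hZV, hfV⟩ := hfV
  have hfA : ∀ a ∈ zerosOnClosure U f, HasFDerivAt f (fderiv ℝ f a) a := fun a ha =>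
    ((hfV.contDiffAt ((hV.inter hU).mem_nhds ⟨hZV ha, hZU a ha⟩)).differentiableAt
      (by norm_num)).hasFDerivAt
  have hfin : (zerosOnClosure U f).Finite :=
    finite_zeros_of_det_ne_zero hUb.isCompact_closure hf (A := fderiv ℝ f)
      (fun a ha ha0 => hfA a ⟨ha, ha0⟩) (fun a ha ha0 => hdet a ⟨ha, ha0⟩)
  refine ⟨hfin, fun hne => ?_⟩
  by_contra! hsol
  refine hne ?_
  rw [finsum_mem_eq_finite_toFinset_sum _ hfin]
  have key := sum_sign_det_eq_zero_of_homotopy hU hUb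
    (F := fun x t => f x + h x t)
    ((hf.comp continuousOn_fst fun p hp => hp.1).add hh) hbd hsol hfin.toFinset
    (fun a ha => hZU a (hfin.mem_toFinset.1 ha))
    (fun x hx => by
      have h2 : h x 0 = 0 := h0' hx
      rw [hfin.mem_toFinset, h2, add_zero]
      exact ⟨fun h3 => ⟨hx, h3⟩, fun h3 => h3.2⟩)
    (A := fderiv ℝ f)
    (fun a ha => by
      rw [hfin.mem_toFinset] at ha
      refine (hfA a ha).congr_of_eventuallyEq ?_
      filter_upwards [hU.mem_nhds (hZU a ha)] with x hx
      rw [h0 x hx, add_zero])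
    (fun a ha => hdet a (hfin.mem_toFinset.1 ha))
  have h3 : ((∑ a ∈ hfin.toFinset, jacobianSign f a : ℤ) : ℝ) = 0 := by
    rw [← key, Int.cast_sum]
    refine Finset.sum_congr rfl fun a _ => ?_
    unfold jacobianSign
    cases SignType.sign (fderiv ℝ f a).det <;> simp
  exact_mod_cast h3

/-- Taking t = 0 puts the whole kernel into the bounded set, and a bounded subspace is trivial. -/
theorem ker_eq_bot_of_isBounded_solutions {E : Type*} [NormedAddCommGroup E] [NormedSpace ℝ E]
    (L : E →ₗ[ℝ] E) (g : E → E)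
    (hS : Bornology.IsBounded {x : E | ∃ t ∈ Icc (0 : ℝ) 1, L x + t • g x = 0}) :
    L.ker = ⊥ := by
  rw [LinearMap.ker_eq_bot']
  intro v hv
  by_contra hv0
  obtain ⟨R, hR⟩ := hS.exists_norm_le
  have hpos : 0 < ‖v‖ := norm_pos_iff.2 hv0
  have h1 := hR (((|R| + 1) / ‖v‖) • v) ⟨0, by simp, by simp [hv]⟩
  rw [norm_smul, Real.norm_of_nonneg (by positivity), div_mul_cancel₀ _ hpos.ne'] at h1
  linarith [le_abs_self R]

theorem exists_linear_add_eq_zero {k : ℕ}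
    (L : EuclideanSpace ℝ (Fin k) →ₗ[ℝ] EuclideanSpace ℝ (Fin k))
    (g : EuclideanSpace ℝ (Fin k) → EuclideanSpace ℝ (Fin k)) (hg : Continuous g)
    (hS : Bornology.IsBounded {x : EuclideanSpace ℝ (Fin k) |
        ∃ t ∈ Icc (0 : ℝ) 1, L x + t • g x = 0}) :
    ∃ x, L x + g x = 0 := by
  have hker := ker_eq_bot_of_isBounded_solutions L g hS
  let A : EuclideanSpace ℝ (Fin k) →L[ℝ] EuclideanSpace ℝ (Fin k) :=
    LinearMap.toContinuousLinearMap L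
  have hdet : A.det ≠ 0 := fun h => LinearMap.det_eq_zero_iff_ker_ne_bot.1 h hker
  -- An open ball containing all solutions leaves none on its frontier.
  obtain ⟨R, hR0, hR⟩ := hS.subset_ball_lt 0 0
  have hzeros : zerosOnClosure (Metric.ball 0 R) A = {0} := by
    ext x
    constructor
    · exact fun hx => LinearMap.ker_eq_bot'.1 hker x hx.2
    · rintro rfl
      exact ⟨subset_closure (Metric.mem_ball_self hR0), map_zero A⟩
  obtain ⟨x, -, hx⟩ := (finite_zeros_and_exists_solution (f := A) (h := fun x t => t • g x)
    Metric.isOpen_ball Metric.isBounded_ball A.continuous.continuousOn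
    ⟨univ, isOpen_univ, subset_univ _, A.contDiff.contDiffOn⟩
    (by fun_prop) (by simp)
    (fun x hx t ht h0 => by
      have h1 := hR ⟨t, ht, h0⟩
      exact hx.2 (by rwa [Metric.isOpen_ball.interior_eq]))
    (fun x _ => by rwa [A.fderiv])).2 (by
      rw [hzeros, finsum_mem_singleton, jacobianSign, A.fderiv]
      have h1 : SignType.sign A.det ≠ 0 := sign_ne_zero.2 hdet
      revert h1
      cases SignType.sign A.det <;> simp)
  exact ⟨x, by simpa [A] using hx⟩

theorem mainTheorem9 (k : ℕ) :
    -- continuation principle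
    (∀ (U : Set (EuclideanSpace ℝ (Fin k)))
      (f : EuclideanSpace ℝ (Fin k) → EuclideanSpace ℝ (Fin k))
      (h : EuclideanSpace ℝ (Fin k) → ℝ → EuclideanSpace ℝ (Fin k)),
      IsOpen U → Bornology.IsBounded U →
      ContinuousOn f (closure U) →
      (∃ V : Set (EuclideanSpace ℝ (Fin k)), IsOpen V ∧ zerosOnClosure U f ⊆ V ∧
        ContDiffOn ℝ 1 f (V ∩ U)) →
      ContinuousOn (fun p : EuclideanSpace ℝ (Fin k) × ℝ => h p.1 p.2)
        (closure U ×ˢ Set.Icc (0 : ℝ) 1) →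
      (∀ x ∈ U, h x 0 = 0) →
      (∀ x ∈ frontier U, ∀ t ∈ Set.Icc (0 : ℝ) 1, f x + h x t ≠ 0) →
      (∀ x ∈ zerosOnClosure U f, (fderiv ℝ f x).det ≠ 0) →
      -- the signed count of zeros is a finite sum, and if it is nonzero there is a solution
      (zerosOnClosure U f).Finite ∧
        ((∑ᶠ x ∈ zerosOnClosure U f, jacobianSign f x) ≠ 0 →
          ∃ x ∈ U, f x + h x 1 = 0)) ∧
    -- corollary for linear plus nonlinear equations
    (∀ (L : EuclideanSpace ℝ (Fin k) →ₗ[ℝ] EuclideanSpace ℝ (Fin k))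
      (g : EuclideanSpace ℝ (Fin k) → EuclideanSpace ℝ (Fin k)),
      Continuous g →
      Bornology.IsBounded {x : EuclideanSpace ℝ (Fin k) |
        ∃ t ∈ Set.Icc (0 : ℝ) 1, L x + t • g x = 0} →
      ∃ x, L x + g x = 0) := by
  exact ⟨fun _ _ _ hU hUb hf hfV hh h0 hbd hdet =>
    finite_zeros_and_exists_solution hU hUb hf hfV hh h0 hbd hdet,
    fun L g hg hS => exists_linear_add_eq_zero L g hg hS⟩
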